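/- Let $x,y$ be variables. A three-step path is a lattice path consisting of up-steps $(1,1)$, level steps $(1,0)$ and down-steps $(1,-1)$; these steps have weights $1$, $x+y$ and $xy$, respectively, and the weight $w(P)$ of a path $P$ is the product of the weights of its steps. For non-negative integers $m,k,l$ let $\mathcal P^+_m(k,l)=\sum_P w(P)$, where $P$ runs over all three-step paths from $(0,k)$ to $(m,l)$ which never run below the $x$-axis. Then, for all positive integers $n$ and non-negative integers $k$, the determinant $$D=\det_{0\le i,j\le n-1}\Big(\sum_{l\ge 0}\mathcal P^+_{i+j+1}(k,l)\Big)$$ has the following values, where $n_1$ denotes a non-negative integer. (1) If $n=(k+1)n_1$, then $$D=(-1)^{n_1\binom{k+1}2}(xy)^{(k+1)^2\binom{n_1+1}2-n}\left(\frac{y^{(k+1)(n_1+1)}-x^{(k+1)(n_1+1)}}{y^{k+1}-x^{k+1}}+(-1)^k\,\frac{y^{(k+1)n_1}-x^{(k+1)n_1}}{y^{k+1}-x^{k+1}}\right).$$ (2) If $k\ge 1$ and $n=(k+1)n_1+1$, then $$D=(-1)^{n_1\binom{k+1}2}(xy)^{(k+1)^2\binom{n_1+1}2}\,\frac{(1+x)(1+y)\left(y^{(k+1)(n_1+1)}-x^{(k+1)(n_1+1)}\right)}{y^{k+1}-x^{k+1}}.$$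 (3) If $k\ge 2$ and $n=(k+1)n_1+k$, then $$D=(-1)^{(n_1+1)\binom{k+1}2+k}(xy)^{(k+1)^2\binom{n_1+1}2+(k^2-1)(n_1+1)}\,\frac{(1+x)(1+y)\left(y^{(k+1)(n_1+1)}-x^{(k+1)(n_1+1)}\right)}{y^{k+1}-x^{k+1}}.$$ (4) If $n\not\equiv 0,1,k\pmod{k+1}$, then $D=0$. These formulas hold for all elements $x,y$ of a field with $x^{k+1}\ne y^{k+1}$, and, if each fraction $\frac{y^{(k+1)N}-x^{(k+1)N}}{y^{k+1}-x^{k+1}}$ is read as the polynomial $\sum_{i=0}^{N-1}y^{(k+1)i}x^{(k+1)(N-1-i)}$, for all elements $x,y$ of a commutative ring. -/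

import Mathlib

open Finset

/-- The steps of a three-step path: up-step `(1,1)`, level step `(1,0)`, down-step `(1,-1)`. -/
inductive PathStep : Type
  | up
  | level
  | down
  deriving DecidableEq

instance : Fintype PathStep where
  elems := {.up, .level, .down}
  complete := by intro s; cases s <;> decide

/-- The change of height along a step. -/
def PathStep.rise : PathStep → ℤ
  | .up => 1
  | .level => 0
  | .down => -1

/-- The weight of a step. -/
def PathStep.weight {R : Type*} [CommRing R] (x y : R) : PathStep → R
  | .up => 1
  | .level => x + y
  | .down => x * y

/-- The height, after its first `m` steps, of the path that starts at height `k` and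
has the step sequence `p`. -/
def pathHeight {n : ℕ} (k : ℤ) (p : Fin n → PathStep) (m : ℕ) : ℤ :=
  k + ∑ i : Fin n with i.val < m, (p i).rise

/-- The generating function of the three-step paths from `(0,k)` to `(n,l)` that never run below
the horizontal axis; the weight of a path is the product of the weights of its steps. -/
def pathGF {R : Type*} [CommRing R] (x y : R) (n : ℕ) (k l : ℤ) : R :=
  ∑ p : Fin n → PathStep with (∀ m ≤ n, 0 ≤ pathHeight k p m) ∧ pathHeight k p n = l,
    ∏ i, (p i).weight x y

/-- The shifted Hankel matrix `(∑_{l ≥ 0} P⁺_{i+j+1}(k,l))`, `0 ≤ i, j ≤ n-1`. All but finitely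
many terms of the sum over `l` vanish. -/
noncomputable def shiftedPrefixHankel {R : Type*} [CommRing R] (x y : R) (n k : ℕ) :
    Matrix (Fin n) (Fin n) R :=
  Matrix.of fun i j => ∑ᶠ l : ℕ, pathGF x y (i.val + j.val + 1) k l

/-- The quotient `(y ^ (m * N) - x ^ (m * N)) / (y ^ m - x ^ m)`, as a polynomial in `x`, `y`. -/
def powQuot {R : Type*} [CommRing R] (x y : R) (m N : ℕ) : R :=
  ∑ i ∈ range N, (y ^ m) ^ i * (x ^ m) ^ (N - 1 - i)

/-- The identity that determines `powQuot` for indeterminates `x`, `y`. -/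
theorem powQuot_mul {R : Type*} [CommRing R] (x y : R) (m N : ℕ) :
    powQuot x y m N * (y ^ m - x ^ m) = y ^ (m * N) - x ^ (m * N) := by
  rw [pow_mul, pow_mul]
  exact (Commute.all (y ^ m) (x ^ m)).geom_sum₂_mul N

/-! Write p_k for `orthoPoly x y k`, q_a for `orthoDiff x y a` and L for `pathFunctional x y`. The
recurrence of p_k mirrors the decomposition of a path by its first step, so L(X^n p_k) is the total
weight of the n-step paths from height k, and the matrix has entries L(T X^i X^j) with T = X p_k
monic of degree k + 1. The polynomials orthogonal for L are the differences q_a = p_a - p_{a-1},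
because L(p_k) = 1 for all k.

A Christoffel-type formula (`det_pathFunctional_mul`) turns the n × n determinant into a (k + 1) ×
(k + 1) one: up to a sign and a power of xy it is the determinant of the remainders of q_n, ...,
q_{n+k} modulo T.

These remainders are governed by a reflection. Put N = (k+1)a + k. Then p_N is a multiple of p_k,
and on multiples of p_k any factor acts modulo X p_k as its constant term. With `orthoPoly_reflect`,
p_{N+j} is congruent to a combination of p_{N-j} and p_N (`dvd_orthoPoly_reflect`), so each block of
k + 1 consecutive p's reduces to the preceding block. Repetition gives the power of xy, and the
constant term of p_N / p_k is the power quotient up to sign. The position of n in its block decides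
which of the four cases arises. -/

/-! ### Paths with free end point. -/

/-- The total weight of the paths with `n` steps that start at height `k` and never run below
the horizontal axis, regardless of their final height. -/
def pathSum {R : Type*} [CommRing R] (x y : R) (n : ℕ) (k : ℤ) : R :=
  ∑ p : Fin n → PathStep with ∀ m ≤ n, 0 ≤ pathHeight k p m, ∏ i, (p i).weight x y

/-- Each admissible path ends at exactly one height; that height is non-negative, so `toNat` loses
nothing. -/
theorem finsum_pathGF {R : Type*} [CommRing R] (x y : R) (n : ℕ) (k : ℤ) :
    ∑ᶠ l : ℕ, pathGF x y n k l = pathSum x y n k := by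
  have h (l : ℕ) : pathGF x y n k l =
      ∑ p : Fin n → PathStep with ∀ m ≤ n, 0 ≤ pathHeight k p m,
        if l = (pathHeight k p n).toNat then ∏ i, (p i).weight x y else 0 := by
    rw [pathGF, ← Finset.filter_filter, Finset.sum_filter]
    refine Finset.sum_congr rfl fun p hp => ?_
    have := (Finset.mem_filter.1 hp).2 n le_rfl
    refine if_congr ?_ rfl rfl
    omega
  simp_rw [h]
  rw [finsum_sum_comm]
  · refine Finset.sum_congr rfl fun p _ => ?_
    rw [finsum_eq_single _ (pathHeight k p n).toNat fun l hl => if_neg hl, if_pos rfl]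
  · intro p _
    refine (Set.finite_singleton (pathHeight k p n).toNat).subset fun l hl => ?_
    by_contra hne
    exact hl (if_neg hne)

theorem pathHeight_zero {n : ℕ} (k : ℤ) (p : Fin n → PathStep) : pathHeight k p 0 = k := by
  simp [pathHeight]

theorem pathHeight_cons_succ {n : ℕ} (k : ℤ) (s : PathStep) (p : Fin n → PathStep) (m : ℕ) :
    pathHeight k (Fin.cons s p : Fin (n + 1) → PathStep) (m + 1) = pathHeight (k + s.rise) p m := by
  simp [pathHeight, Finset.sum_filter, Fin.sum_univ_succ, add_assoc]

theorem pathSum_zero {R : Type*} [CommRing R] (x y : R) {k : ℤ} (hk : 0 ≤ k) :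
    pathSum x y 0 k = 1 := by
  simp [pathSum, pathHeight_zero, hk]

theorem pathSum_of_neg {R : Type*} [CommRing R] (x y : R) (n : ℕ) {k : ℤ} (hk : k < 0) :
    pathSum x y n k = 0 := by
  rw [pathSum, Finset.filter_eq_empty_iff.2, Finset.sum_empty]
  intro p _ h
  have := h 0 (Nat.zero_le _)
  rw [pathHeight_zero] at this
  omega

theorem pathSum_succ {R : Type*} [CommRing R] (x y : R) (n : ℕ) {k : ℤ} (hk : 0 ≤ k) :
    pathSum x y (n + 1) k = pathSum x y n (k + 1) + (x + y) * pathSum x y n k +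
      x * y * pathSum x y n (k - 1) := by
  have key (s : PathStep) (p : Fin n → PathStep) :
      (∀ m ≤ n + 1, 0 ≤ pathHeight k (Fin.cons s p : Fin (n + 1) → PathStep) m) ↔
        ∀ m ≤ n, 0 ≤ pathHeight (k + s.rise) p m := by
    constructor
    · intro h m hm
      rw [← pathHeight_cons_succ]
      exact h _ (by omega)
    · rintro h (_ | m) hm
      · rwa [pathHeight_zero]
      · rw [pathHeight_cons_succ]
        exact h _ (by omega)
  have hstep : (Finset.univ : Finset PathStep) = {.up, .level, .down} := rfl
  have hsum (s : PathStep) :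
      (∑ p : Fin n → PathStep, if ∀ m ≤ n, 0 ≤ pathHeight (k + s.rise) p m then
        s.weight x y * ∏ i, (p i).weight x y else 0) =
        s.weight x y * pathSum x y n (k + s.rise) := by
    rw [pathSum, Finset.mul_sum, Finset.sum_filter]
  rw [pathSum, Finset.sum_filter, ← (Fin.consEquiv fun _ => PathStep).sum_comp,
    Fintype.sum_prod_type]
  simp only [Fin.consEquiv, Equiv.coe_fn_mk, key, Fin.prod_univ_succ, Fin.cons_zero, Fin.cons_succ,
    hsum, hstep]
  simp [PathStep.rise, PathStep.weight, sub_eq_add_neg, add_assoc]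

/-! ### The moment functional and its orthogonal polynomials. -/

open Polynomial

/-- The monic orthogonal polynomials with constant recurrence coefficients `x + y` and `x * y`. -/
noncomputable def orthoPoly {R : Type*} [CommRing R] (x y : R) : ℕ → R[X]
  | 0 => 1
  | 1 => X - C (x + y)
  | n + 2 => (X - C (x + y)) * orthoPoly x y (n + 1) - C (x * y) * orthoPoly x y n

/-- The differences of consecutive orthogonal polynomials. -/
noncomputable def orthoDiff {R : Type*} [CommRing R] (x y : R) : ℕ → R[X]
  | 0 => 1
  | n + 1 => orthoPoly x y (n + 1) - orthoPoly x y n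

/-- The linear functional whose moments are the total weights of paths starting at height `0`. -/
noncomputable def pathFunctional {R : Type*} [CommRing R] (x y : R) : R[X] →ₗ[R] R :=
  Polynomial.lsum fun n => LinearMap.mulRight R (pathSum x y n 0)

section

variable {R : Type*} [CommRing R] (x y : R)

theorem orthoPoly_add_two (n : ℕ) : orthoPoly x y (n + 2) =
    (X - C (x + y)) * orthoPoly x y (n + 1) - C (x * y) * orthoPoly x y n := by
  simp only [orthoPoly]

theorem pathFunctional_X_pow (n : ℕ) : pathFunctional x y (X ^ n) = pathSum x y n 0 := by
  simp [pathFunctional, Polynomial.lsum_apply, ← Polynomial.monomial_one_right_eq_X_pow,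
    Polynomial.sum_monomial_index]

theorem pathFunctional_C_mul (a : R) (f : R[X]) :
    pathFunctional x y (C a * f) = a * pathFunctional x y f := by
  rw [← smul_eq_C_mul, map_smul, smul_eq_mul]

/-- The recurrence of `orthoPoly` solves the first-step recurrence `pathSum_succ` for the term of
greatest starting height; at height 0 the down-step contributes nothing. -/
theorem pathFunctional_X_pow_mul_orthoPoly (k n : ℕ) :
    pathFunctional x y (X ^ n * orthoPoly x y k) = pathSum x y n k := by
  induction k using Nat.twoStepInduction generalizing n with
  | zero => simp [orthoPoly, pathFunctional_X_pow]
  | one =>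
    rw [orthoPoly, mul_sub, ← pow_succ, mul_comm _ (C _), map_sub, pathFunctional_C_mul,
      pathFunctional_X_pow, pathFunctional_X_pow, pathSum_succ x y n le_rfl,
      pathSum_of_neg x y n (k := 0 - 1) (by norm_num)]
    norm_num
  | more k ih1 ih2 =>
    have h : (X : R[X]) ^ n * orthoPoly x y (k + 2) = X ^ (n + 1) * orthoPoly x y (k + 1) -
        C (x + y) * (X ^ n * orthoPoly x y (k + 1)) - C (x * y) * (X ^ n * orthoPoly x y k) := by
      rw [orthoPoly]; ring
    rw [h, map_sub, map_sub, pathFunctional_C_mul, pathFunctional_C_mul, ih1, ih2, ih2,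
      pathSum_succ x y n (by positivity)]
    push_cast
    rw [show (k : ℤ) + 1 + 1 = k + 2 by ring, show (k : ℤ) + 1 - 1 = k by ring]
    ring

theorem X_mul_orthoDiff (a : ℕ) : X * orthoDiff x y (a + 1) = orthoDiff x y (a + 2) +
    C (x + y) * orthoDiff x y (a + 1) + C (x * y) * orthoDiff x y a := by
  rcases a with _ | a
  · simp only [orthoDiff, orthoPoly]; ring
  · simp only [orthoDiff, orthoPoly]; ring

/-- The functional is 1 on every `orthoPoly`, since only the empty path has no steps; hence it kills
consecutive differences. -/
theorem pathFunctional_orthoDiff (a : ℕ) :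
    pathFunctional x y (orthoDiff x y a) = if a = 0 then 1 else 0 := by
  have h (k : ℕ) : pathFunctional x y (orthoPoly x y k) = 1 := by
    rw [← one_mul (orthoPoly x y k), ← pow_zero X, pathFunctional_X_pow_mul_orthoPoly,
      pathSum_zero x y (by positivity)]
  rcases a with _ | a
  · simpa [orthoPoly, orthoDiff] using h 0
  · simp [orthoDiff, h]

/-- Each factor X lowers the index by at most one, so fewer than a factors never reach index 0. -/
theorem pathFunctional_X_pow_mul_orthoDiff_of_lt {j a : ℕ} (h : j < a) :
    pathFunctional x y (X ^ j * orthoDiff x y a) = 0 := by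
  induction j generalizing a with
  | zero => rw [pow_zero, one_mul, pathFunctional_orthoDiff, if_neg (by omega)]
  | succ j ih =>
    obtain ⟨a, rfl⟩ : ∃ b, a = b + 1 := ⟨a - 1, by omega⟩
    rw [pow_succ, mul_assoc, X_mul_orthoDiff, mul_add, mul_add, mul_left_comm, mul_left_comm _ (C _),
      map_add, map_add, pathFunctional_C_mul, pathFunctional_C_mul, ih (by omega), ih (by omega),
      ih (by omega)]
    ring

theorem pathFunctional_X_pow_mul_orthoDiff_self (a : ℕ) :
    pathFunctional x y (X ^ a * orthoDiff x y a) = (x * y) ^ a := by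
  induction a with
  | zero => rw [pow_zero, one_mul, pathFunctional_orthoDiff, if_pos rfl, pow_zero]
  | succ a ih =>
    rw [pow_succ, mul_assoc, X_mul_orthoDiff, mul_add, mul_add, mul_left_comm, mul_left_comm _ (C _),
      map_add, map_add, pathFunctional_C_mul, pathFunctional_C_mul,
      pathFunctional_X_pow_mul_orthoDiff_of_lt x y (by omega),
      pathFunctional_X_pow_mul_orthoDiff_of_lt x y (by omega), ih]
    ring

theorem orthoPoly_degree [Nontrivial R] (n : ℕ) : (orthoPoly x y n).Monic ∧
    (orthoPoly x y n).degree = n := by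
  induction n using Nat.twoStepInduction with
  | zero => simp [orthoPoly]
  | one => simp [orthoPoly, monic_X_sub_C, -map_add]
  | more n ih1 ih2 =>
    have hd : ((X - C (x + y)) * orthoPoly x y (n + 1)).degree = ((n + 2 : ℕ) : WithBot ℕ) := by
      rw [ih2.1.degree_mul, degree_X_sub_C, ih2.2]; norm_cast; omega
    have hlt : (C (x * y) * orthoPoly x y n).degree <
        ((X - C (x + y)) * orthoPoly x y (n + 1)).degree := by
      rw [hd]
      rw [← smul_eq_C_mul]
      refine (degree_smul_le _ _).trans_lt ?_
      rw [ih1.2]; norm_cast; omega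
    rw [orthoPoly_add_two]
    exact ⟨((monic_X_sub_C _).mul ih2.1).sub_of_left hlt,
      (degree_sub_eq_left_of_degree_lt hlt).trans hd⟩

theorem orthoPoly_monic (n : ℕ) : (orthoPoly x y n).Monic := by
  nontriviality R
  exact (orthoPoly_degree x y n).1

theorem orthoPoly_natDegree [Nontrivial R] (n : ℕ) : (orthoPoly x y n).natDegree = n :=
  natDegree_eq_of_degree_eq_some (orthoPoly_degree x y n).2

theorem orthoDiff_degree [Nontrivial R] (n : ℕ) : (orthoDiff x y n).Monic ∧
    (orthoDiff x y n).natDegree = n := by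
  rcases n with _ | n
  · simp [orthoDiff]
  · have hlt : (orthoPoly x y n).degree < (orthoPoly x y (n + 1)).degree := by
      rw [(orthoPoly_degree x y _).2, (orthoPoly_degree x y _).2]; norm_cast; omega
    rw [orthoDiff]
    exact ⟨(orthoPoly_monic x y _).sub_of_left hlt, natDegree_eq_of_degree_eq_some
      ((degree_sub_eq_left_of_degree_lt hlt).trans (orthoPoly_degree x y _).2)⟩

end

/-! ### Signs of reversal and of block exchange. -/

theorem Equiv.Perm.sign_finRevPerm (n : ℕ) :
    Equiv.Perm.sign (Fin.revPerm : Equiv.Perm (Fin n)) = (-1) ^ n.choose 2 := by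
  rw [Equiv.Perm.sign_eq_prod_prod_Ioi]
  have h (i : Fin n) : (∏ j ∈ Finset.Ioi i,
      if Fin.revPerm i < Fin.revPerm j then (1 : ℤˣ) else -1) = (-1) ^ (n - 1 - i : ℕ) := by
    rw [Finset.prod_congr rfl (g := fun _ => (-1 : ℤˣ)), Finset.prod_const, Fin.card_Ioi]
    intro j hj
    rw [if_neg]
    simpa using (Finset.mem_Ioi.1 hj).le
  simp_rw [h]
  rw [Finset.prod_pow_eq_pow_sum, Fin.sum_univ_eq_sum_range (fun i => n - 1 - i),
    Finset.sum_range_reflect (fun i => i), Finset.sum_range_id, Nat.choose_two_right]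

/-- The permutation that exchanges the blocks of lengths `n` and `m`. -/
def blockSwap (n m : ℕ) : Equiv.Perm (Fin n ⊕ Fin m) :=
  (finSumFinEquiv.trans (finCongr (Nat.add_comm n m))).trans
    (finSumFinEquiv.symm.trans (Equiv.sumComm (Fin m) (Fin n)))

/-- The inversions are exactly the pairs with one index in each block. -/
theorem sign_blockSwap (n m : ℕ) : Equiv.Perm.sign (blockSwap n m) = (-1) ^ (n * m) := by
  have h : Equiv.Perm.sign (blockSwap n m) = Equiv.Perm.sign
      ((finSumFinEquiv (m := n) (n := m)).permCongr (blockSwap n m).symm) := by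
    rw [Equiv.Perm.sign_permCongr, Equiv.Perm.sign_symm]
  have hIoi (i : Fin (n + m)) (g : Fin (n + m) → ℤˣ) :
      ∏ j ∈ Finset.Ioi i, g j = ∏ j, if i < j then g j else 1 := by
    rw [← Finset.prod_filter]
    congr 1
    ext j
    simp
  rw [h, Equiv.Perm.sign_eq_prod_prod_Ioi]
  simp_rw [hIoi, ← finSumFinEquiv.prod_comp, Fintype.prod_sum_type, Equiv.permCongr_apply,
    Equiv.symm_apply_apply]
  have hl (i : Fin n) : (finSumFinEquiv ((blockSwap n m).symm (.inl i)) : ℕ) = m + i := by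
    simp [blockSwap, add_comm]
  have hr (j : Fin m) : (finSumFinEquiv ((blockSwap n m).symm (.inr j)) : ℕ) = j := by
    simp [blockSwap]
  simp only [Fin.lt_def, hl, hr, finSumFinEquiv_apply_left, finSumFinEquiv_apply_right,
    Fin.val_castAdd, Fin.val_natAdd]
  have h1 {N : ℕ} (a b : Fin N) :
      (if a < b then if a < b then (1 : ℤˣ) else -1 else 1) = 1 := by
    split_ifs <;> rfl
  have h2 (a : Fin n) (b : Fin m) :
      (if (a : ℕ) < n + b then if m + (a : ℕ) < b then (1 : ℤˣ) else -1 else 1) = -1 := by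
    rw [if_pos (by omega), if_neg (by omega)]
  have h3 (a : Fin n) (b : Fin m) :
      (if n + (b : ℕ) < a then if (b : ℕ) < m + a then (1 : ℤˣ) else -1 else 1) = 1 := by
    rw [if_neg (by omega)]
  simp [h1, h2, h3, mul_comm n, pow_mul]

/-! ### A Christoffel-type formula for Hankel determinants. -/

section

variable {R : Type*} [CommRing R]

/-- The position of an index in the concatenation of two blocks. -/
def blockIdx (n m : ℕ) : Fin n ⊕ Fin m → ℕ :=
  Sum.elim (fun i => (i : ℕ)) fun j => n + j

theorem det_of_coeff_blockIdx (n m : ℕ) (f : ℕ → R[X]) (hf : ∀ i, (f i).Monic)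
    (hd : ∀ i, (f i).natDegree = i) :
    (Matrix.of fun s t : Fin n ⊕ Fin m =>
      (f (blockIdx n m s)).coeff (blockIdx n m t)).det = 1 := by
  have h : (Matrix.of fun s t : Fin n ⊕ Fin m =>
      (f (blockIdx n m s)).coeff (blockIdx n m t)) =
      (Matrix.of fun i j : Fin (n + m) => (f i).coeff j).submatrix finSumFinEquiv
        finSumFinEquiv := by
    ext (i | i) (j | j) <;> simp [blockIdx]
  rw [h, Matrix.det_submatrix_equiv_self, Matrix.det_of_isLowerTriangular]
  · refine Finset.prod_eq_one fun i _ => ?_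
    have := (hf i).coeff_natDegree
    rwa [hd] at this
  · intro i j hij
    refine coeff_eq_zero_of_natDegree_lt ?_
    rw [hd]
    exact hij

/-- In the order 1, ..., X^(m-1), T, ..., T X^(n-1) the polynomials are monic of degrees 0, ..., n +
m - 1, so the coefficient matrix is unitriangular; the sign comes from exchanging the blocks. -/
theorem det_of_mul_X_pow_coeff_blockIdx [Nontrivial R] (n m : ℕ) {T : R[X]} (hT : T.Monic)
    (hd : T.natDegree = m) :
    (Matrix.of fun s t : Fin n ⊕ Fin m => (Sum.elim (fun i : Fin n => T * X ^ (i : ℕ))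
      (fun j : Fin m => X ^ (j : ℕ)) s).coeff (blockIdx n m t)).det = (-1) ^ (n * m) := by
  let f : ℕ → R[X] := fun i => if i < m then X ^ i else T * X ^ (i - m)
  have h : (Matrix.of fun s t : Fin n ⊕ Fin m => (Sum.elim (fun i : Fin n => T * X ^ (i : ℕ))
      (fun j : Fin m => X ^ (j : ℕ)) s).coeff (blockIdx n m t)) =
      ((Matrix.of fun s t : Fin m ⊕ Fin n =>
        (f (blockIdx m n s)).coeff (blockIdx m n t)).submatrix (Equiv.sumComm _ _)
          (Equiv.sumComm _ _)).submatrix id (blockSwap n m) := by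
    have hidx (t : Fin n ⊕ Fin m) : blockIdx m n ((blockSwap n m t).swap) = blockIdx n m t := by
      have h2 (s : Fin m ⊕ Fin n) : blockIdx m n s = finSumFinEquiv s := by
        rcases s with s | s <;> simp [blockIdx]
      rw [h2]
      rcases t with t | t <;> simp [blockIdx, blockSwap, add_comm]
    ext s t
    simp only [Matrix.submatrix_apply, Matrix.of_apply, Equiv.sumComm_apply, id, hidx]
    rcases s with s | s <;> simp [f, blockIdx]
  rw [h, Matrix.det_permute', Matrix.det_submatrix_equiv_self, det_of_coeff_blockIdx, mul_one,
    sign_blockSwap]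
  · simp
  · intro i
    by_cases hi : i < m
    · simp [f, hi]
    · simpa [f, hi] using hT.mul (monic_X_pow _)
  · intro i
    by_cases hi : i < m
    · simp [f, hi]
    · simp only [f, hi, if_false]
      rw [hT.natDegree_mul (monic_X_pow _), natDegree_X_pow, hd]
      omega

/-- The determinant of the coefficients of the remainders of `m` polynomials modulo `T`. -/
noncomputable def remDet (T : R[X]) {m : ℕ} (h : Fin m → R[X]) : R :=
  (Matrix.of fun i j : Fin m => (h i %ₘ T).coeff j).det

theorem eq_sum_coeff_blockIdx (n m : ℕ) {f : R[X]} (hf : f.natDegree < n + m) :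
    f = ∑ t : Fin n ⊕ Fin m, C (f.coeff (blockIdx n m t)) * X ^ blockIdx n m t := by
  conv_lhs => rw [f.as_sum_range_C_mul_X_pow' hf]
  rw [← Fin.sum_univ_eq_sum_range (fun i => C (f.coeff i) * X ^ i), ← finSumFinEquiv.sum_comp]
  refine Finset.sum_congr rfl fun t _ => ?_
  rcases t with t | t <;> simp [blockIdx]

theorem eq_mul_sum_add_sum_rem [Nontrivial R] (n m : ℕ) {T f : R[X]} (hT : T.Monic)
    (hd : T.natDegree = m) (hf : f.natDegree < n + m) :
    f = ∑ i : Fin n, C ((f /ₘ T).coeff i) * (T * X ^ (i : ℕ)) +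
      ∑ j : Fin m, C ((f %ₘ T).coeff j) * X ^ (j : ℕ) := by
  -- Here T = 1, which the degree bound for remainders excludes.
  by_cases hm : m = 0
  · subst hm
    obtain rfl : T = 1 := hT.natDegree_eq_zero.1 hd
    simpa [Fin.sum_univ_eq_sum_range (fun i => C (f.coeff i) * X ^ i)] using
      f.as_sum_range_C_mul_X_pow' hf
  have hq : (f /ₘ T).natDegree < n ∨ f /ₘ T = 0 := by
    by_cases hfm : f.natDegree < m
    · right
      refine (divByMonic_eq_zero_iff hT).2 (degree_lt_degree ?_)
      rwa [hd]
    · left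
      rw [natDegree_divByMonic f hT, hd]
      omega
  have hr : (f %ₘ T).natDegree < m := by
    rw [← hd]
    refine natDegree_modByMonic_lt f hT ?_
    rintro rfl
    exact hm (by simpa using hd.symm)
  have h1 : f /ₘ T = ∑ i : Fin n, C ((f /ₘ T).coeff i) * X ^ (i : ℕ) := by
    rw [Fin.sum_univ_eq_sum_range (fun i => C ((f /ₘ T).coeff i) * X ^ i)]
    rcases hq with hq | hq
    · exact as_sum_range_C_mul_X_pow' _ hq
    · simp [hq]
  have h2 : f %ₘ T = ∑ j : Fin m, C ((f %ₘ T).coeff j) * X ^ (j : ℕ) := by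
    rw [Fin.sum_univ_eq_sum_range (fun i => C ((f %ₘ T).coeff i) * X ^ i)]
    exact as_sum_range_C_mul_X_pow' _ hr
  conv_lhs => rw [← modByMonic_add_div f T, add_comm, h1, h2, Finset.mul_sum]
  simp only [mul_left_comm]

/-- Division by T is a row operation: the quotients are absorbed by the rows T X^i, and only the
remainders are left. -/
theorem det_elim_coeff_eq_remDet [Nontrivial R] (n m : ℕ) {T : R[X]} (hT : T.Monic)
    (hd : T.natDegree = m) (h : Fin m → R[X]) (hh : ∀ j, (h j).natDegree < n + m) :
    (Matrix.of fun s t : Fin n ⊕ Fin m => (Sum.elim (fun i : Fin n => T * X ^ (i : ℕ))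
      h s).coeff (blockIdx n m t)).det = (-1) ^ (n * m) * remDet T h := by
  have key : (Matrix.of fun s t : Fin n ⊕ Fin m => (Sum.elim (fun i : Fin n => T * X ^ (i : ℕ))
      h s).coeff (blockIdx n m t)) =
      Matrix.fromBlocks (1 : Matrix (Fin n) (Fin n) R) 0
        (Matrix.of fun (j : Fin m) (i : Fin n) => (h j /ₘ T).coeff i)
        (Matrix.of fun i j : Fin m => (h i %ₘ T).coeff j) *
      (Matrix.of fun s t : Fin n ⊕ Fin m => (Sum.elim (fun i : Fin n => T * X ^ (i : ℕ))
        (fun j : Fin m => X ^ (j : ℕ)) s).coeff (blockIdx n m t)) := by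
    ext (s | s) t
    · simp [Matrix.mul_apply, Matrix.one_apply]
    · rw [Matrix.of_apply, Sum.elim_inr]
      conv_lhs => rw [eq_mul_sum_add_sum_rem n m hT hd (hh s)]
      simp [Matrix.mul_apply, coeff_C_mul]
  rw [key, Matrix.det_mul, Matrix.det_fromBlocks_zero₁₂, Matrix.det_one, one_mul,
    det_of_mul_X_pow_coeff_blockIdx n m hT hd, mul_comm, remDet]

/-- The determinant with rows T X^i and q_{n+j} is evaluated twice: by expanding T X^i in the basis
of the q's, and by reducing the q_{n+j} modulo T. -/
theorem det_pathFunctional_mul [Nontrivial R] (x y : R) (n m : ℕ) {T : R[X]} (hT : T.Monic)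
    (hd : T.natDegree = m) :
    (Matrix.of fun i j : Fin n => pathFunctional x y (T * X ^ (i : ℕ) * X ^ (j : ℕ))).det =
      (-1) ^ (n * m) * (x * y) ^ n.choose 2 *
        remDet T (fun j : Fin m => orthoDiff x y (n + j)) := by
  let P : Matrix (Fin n ⊕ Fin m) (Fin n ⊕ Fin m) R := Matrix.of fun s t =>
    (orthoDiff x y (blockIdx n m s)).coeff (blockIdx n m t)
  have hP : P.det = 1 := det_of_coeff_blockIdx n m (orthoDiff x y)
    (fun i => (orthoDiff_degree x y i).1) fun i => (orthoDiff_degree x y i).2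
  let F : Matrix (Fin n) (Fin n ⊕ Fin m) R := Matrix.of fun i t =>
    (T * X ^ (i : ℕ)).coeff (blockIdx n m t)
  let H : Matrix (Fin n ⊕ Fin m) (Fin n) R := Matrix.of fun t j =>
    pathFunctional x y (X ^ blockIdx n m t * X ^ (j : ℕ))
  let G : Matrix (Fin n) (Fin n) R := Matrix.of fun i j =>
    pathFunctional x y (X ^ (j : ℕ) * orthoDiff x y i)
  -- The rows of `E` are the coordinates of T X^i in the basis q_0, ..., q_{n+m-1}.
  let E := F * P⁻¹
  have hE : E * P = F := by
    rw [Matrix.mul_assoc, Matrix.nonsing_inv_mul P (by rw [hP]; exact isUnit_one), Matrix.mul_one]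
  have hG : G.det = (x * y) ^ n.choose 2 := by
    rw [Matrix.det_of_isUpperTriangular, Nat.choose_two_right, ← Finset.sum_range_id,
      ← Finset.prod_pow_eq_pow_sum, ← Fin.prod_univ_eq_prod_range (fun i => (x * y) ^ i)]
    · exact Finset.prod_congr rfl fun i _ => pathFunctional_X_pow_mul_orthoDiff_self x y i
    · intro i j hij
      exact pathFunctional_X_pow_mul_orthoDiff_of_lt x y hij
  have hpair (f : R[X]) (hf : f.natDegree < n + m) (j : Fin n) :
      pathFunctional x y (f * X ^ (j : ℕ)) = ∑ t, f.coeff (blockIdx n m t) * H t j := by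
    conv_lhs => rw [eq_sum_coeff_blockIdx n m hf, Finset.sum_mul, map_sum]
    refine Finset.sum_congr rfl fun t _ => ?_
    rw [mul_assoc, pathFunctional_C_mul]
    rfl
  have hidx (s : Fin n ⊕ Fin m) : blockIdx n m s < n + m := by
    rcases s with s | s <;> simp [blockIdx]; omega
  -- By orthogonality q_n, ..., q_{n+m-1} pair to zero with every X^j, j < n, so only the left block
  -- of `E` matters.
  have hPH : P * H = Matrix.of (Sum.elim (fun i j => G i j) fun _ _ => 0) := by
    ext s j
    have h := hpair (orthoDiff x y (blockIdx n m s))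
      (by rw [(orthoDiff_degree x y _).2]; exact hidx s) j
    rw [mul_comm] at h
    rw [Matrix.mul_apply]
    refine h.symm.trans ?_
    rcases s with s | s
    · rfl
    · exact pathFunctional_X_pow_mul_orthoDiff_of_lt x y (by simp only [blockIdx, Sum.elim_inr]; omega)
  have hF : (Matrix.of fun i j : Fin n => pathFunctional x y (T * X ^ (i : ℕ) * X ^ (j : ℕ))) =
      F * H := by
    ext i j
    refine hpair (T * X ^ (i : ℕ)) ?_ j
    rw [hT.natDegree_mul (monic_X_pow _), natDegree_X_pow, hd]
    omega
  have hD : (Matrix.of fun i j : Fin n => pathFunctional x y (T * X ^ (i : ℕ) * X ^ (j : ℕ))) =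
      E.submatrix id Sum.inl * G := by
    rw [hF, ← hE, Matrix.mul_assoc, hPH]
    ext i j
    simp [Matrix.mul_apply]
  have hX : (Matrix.of fun s t : Fin n ⊕ Fin m => (Sum.elim (fun i : Fin n => T * X ^ (i : ℕ))
      (fun j : Fin m => orthoDiff x y (n + j)) s).coeff (blockIdx n m t)) =
      Matrix.fromBlocks (E.submatrix id Sum.inl) (E.submatrix id Sum.inr) 0 1 * P := by
    ext (s | s) t
    · refine (congrFun (congrFun hE s) t).symm.trans ?_
      simp [Matrix.mul_apply]
    · simp [Matrix.mul_apply, Matrix.one_apply, P, blockIdx]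
  have hdet := det_elim_coeff_eq_remDet n m hT hd (fun j => orthoDiff x y (n + j))
    fun j => by rw [(orthoDiff_degree x y _).2]; omega
  rw [hX, Matrix.det_mul, Matrix.det_fromBlocks_zero₂₁, Matrix.det_one, hP, mul_one, mul_one]
    at hdet
  rw [hD, Matrix.det_mul, hdet, hG]
  ring

theorem det_shiftedPrefixHankel [Nontrivial R] (x y : R) (n k : ℕ) :
    (shiftedPrefixHankel x y n k).det = (-1) ^ (n * (k + 1)) * (x * y) ^ n.choose 2 *
      remDet (X * orthoPoly x y k) (fun j : Fin (k + 1) => orthoDiff x y (n + j)) := by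
  rw [← det_pathFunctional_mul x y n (k + 1) (monic_X.mul (orthoPoly_monic x y k))
    (by rw [monic_X.natDegree_mul (orthoPoly_monic x y k), natDegree_X, orthoPoly_natDegree,
      add_comm])]
  congr 1
  ext i j
  rw [shiftedPrefixHankel, Matrix.of_apply, Matrix.of_apply, finsum_pathGF,
    ← pathFunctional_X_pow_mul_orthoPoly]
  congr 1
  ring

end

/-! ### Remainders modulo X p_k: reflection and reduction of blocks. -/

section

variable {R : Type*} [CommRing R]

theorem remDet_eq_det_mul {T : R[X]} (hT : T.Monic) {m : ℕ} (Z : Matrix (Fin m) (Fin m) R)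
    {h h' : Fin m → R[X]} (H : ∀ i, T ∣ h i - ∑ j, C (Z i j) * h' j) :
    remDet T h = Z.det * remDet T h' := by
  rw [remDet, remDet, ← Matrix.det_mul]
  congr 1
  ext i l
  have hi : h i %ₘ T = ∑ j, Z i j • (h' j %ₘ T) := by
    rw [modByMonic_eq_of_dvd_sub hT (H i)]
    change modByMonicHom T _ = ∑ j, Z i j • modByMonicHom T (h' j)
    simp only [map_sum, ← smul_eq_C_mul, map_smul]
  rw [Matrix.of_apply, hi, Matrix.mul_apply]
  simp

theorem remDet_comp_perm (T : R[X]) {m : ℕ} (σ : Equiv.Perm (Fin m)) (h : Fin m → R[X]) :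
    remDet T (h ∘ σ) = Equiv.Perm.sign σ * remDet T h :=
  Matrix.det_permute σ (Matrix.of fun i j : Fin m => (h i %ₘ T).coeff j)

/-- Up to multiples of the last polynomial, the polynomials are permuted and rescaled. -/
theorem remDet_eq_of_castSucc {T : R[X]} (hT : T.Monic) {k : ℕ} {h h' : Fin (k + 1) → R[X]}
    (σ : Equiv.Perm (Fin k)) (d s : Fin k → R) (γ : R)
    (H : ∀ b : Fin k, T ∣ h b.castSucc -
      (C (d b) * h' (σ b).castSucc + C (s b) * h' (Fin.last k)))
    (hlast : T ∣ h (Fin.last k) - C γ * h' (Fin.last k)) :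
    remDet T h = γ * (Equiv.Perm.sign σ * ∏ b, d b) * remDet T h' := by
  let Z : Matrix (Fin (k + 1)) (Fin (k + 1)) R := Matrix.of <| Fin.lastCases
    (Fin.lastCases γ fun _ => 0)
    fun b => Fin.lastCases (s b) fun b' => if σ b = b' then d b else 0
  have hZ : Z.det = γ * (Equiv.Perm.sign σ * ∏ b, d b) := by
    have hsub : Z.submatrix Fin.castSucc Fin.castSucc =
        Matrix.diagonal d * (1 : Matrix (Fin k) (Fin k) R).submatrix σ id := by
      ext b b'
      simp [Z, Matrix.one_apply]
    rw [Matrix.det_succ_row Z (Fin.last k), Fin.sum_univ_castSucc, Finset.sum_eq_zero]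
    · have : (Fin.last k).succAbove = Fin.castSucc := Fin.succAbove_last
      rw [this, hsub, Matrix.det_mul, Matrix.det_diagonal, Matrix.det_permute, Matrix.det_one]
      simp [Z, ← two_mul]
      ring
    · intro b _
      simp [Z]
  rw [remDet_eq_det_mul hT Z (h' := h'), hZ]
  intro i
  refine Fin.lastCases ?_ (fun b => ?_) i
  · simpa [Z, Fin.sum_univ_castSucc] using hlast
  · simpa [Z, Fin.sum_univ_castSucc, apply_ite C, ite_mul] using H b

theorem sum_C_ite_mul {m c : ℕ} (hc : c < m) (a : R) (F : ℕ → R[X]) :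
    ∑ j : Fin m, C (if (j : ℕ) = c then a else 0) * F j = C a * F c := by
  rw [Finset.sum_eq_single (⟨c, hc⟩ : Fin m)]
  · simp
  · intro j _ hj
    rw [if_neg fun h => hj (Fin.ext h)]
    simp
  · simp

variable (x y : R)

/-- The polynomials that satisfy the recurrence of the orthogonal polynomials, with initial
values `2` and `X - (x + y)`. -/
noncomputable def reflPoly : ℕ → R[X]
  | 0 => 2
  | 1 => X - C (x + y)
  | n + 2 => (X - C (x + y)) * reflPoly (n + 1) - C (x * y) * reflPoly n

/-- `reflPoly` is α^j + β^j where α + β = X - (x + y) and αβ = xy; at X = 0 these are -x and -y. -/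
theorem reflPoly_coeff_zero (j : ℕ) :
    (reflPoly x y j).coeff 0 = (-1) ^ j * (x ^ j + y ^ j) := by
  induction j using Nat.twoStepInduction with
  | zero => simp [reflPoly]; norm_num
  | one => simp [reflPoly]
  | more j ih1 ih2 =>
    simp only [reflPoly, coeff_sub, mul_coeff_zero, ih1, ih2, coeff_X_zero, coeff_C_zero]
    ring

theorem orthoPoly_reflect {N j : ℕ} (hj : j ≤ N) : orthoPoly x y (N + j) =
    orthoPoly x y N * reflPoly x y j - C ((x * y) ^ j) * orthoPoly x y (N - j) := by
  induction j using Nat.twoStepInduction with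
  | zero => simp [reflPoly]; ring
  | one =>
    obtain ⟨N, rfl⟩ : ∃ M, N = M + 1 := ⟨N - 1, by omega⟩
    rw [show N + 1 + 1 = N + 2 by ring, orthoPoly_add_two, Nat.add_sub_cancel, reflPoly, pow_one]
    ring
  | more j ih1 ih2 =>
    obtain ⟨N, rfl⟩ : ∃ M, N = M + j + 2 := ⟨N - j - 2, by omega⟩
    have h1 := ih1 (by omega)
    have h2 := ih2 (by omega)
    rw [show N + j + 2 - j = N + 2 by omega, orthoPoly_add_two x y N] at h1
    rw [show N + j + 2 - (j + 1) = N + 1 by omega] at h2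
    rw [show N + j + 2 - (j + 2) = N by omega, ← add_assoc, orthoPoly_add_two,
      show N + j + 2 + j + 1 = N + j + 2 + (j + 1) by ring, h1, h2, reflPoly]
    simp only [map_pow]
    ring

/-- This is the reflection with j = N + 1, where the reflected term has index -1 and vanishes;
natural subtraction does not cover it. -/
theorem orthoPoly_two_mul_add_one (N : ℕ) :
    orthoPoly x y (2 * N + 1) = orthoPoly x y N * reflPoly x y (N + 1) := by
  rcases N with _ | N
  · simp [orthoPoly, reflPoly]
  · have h1 := orthoPoly_reflect x y (N := N + 1) (j := N) (by omega)
    have h2 := orthoPoly_reflect x y (N := N + 1) (j := N + 1) le_rfl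
    rw [Nat.add_sub_cancel_left] at h1
    rw [Nat.sub_self] at h2
    rw [show 2 * (N + 1) + 1 = N + 1 + N + 2 by ring, orthoPoly_add_two, h1,
      show N + 1 + N + 1 = N + 1 + (N + 1) by ring, h2, reflPoly]
    simp only [map_pow, orthoPoly]
    ring

/-- The quotient of `orthoPoly x y ((k + 1) * a + k)` by `orthoPoly x y k`. -/
noncomputable def orthoQuot (k : ℕ) : ℕ → R[X]
  | 0 => 1
  | 1 => reflPoly x y (k + 1)
  | a + 2 => reflPoly x y (k + 1) * orthoQuot k (a + 1) - C ((x * y) ^ (k + 1)) * orthoQuot k a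

/-- Reflection with j = k + 1 links three consecutive indices congruent to k modulo k + 1, so
divisibility by p_k propagates. -/
theorem orthoPoly_eq_mul_orthoQuot (k a : ℕ) :
    orthoPoly x y ((k + 1) * a + k) = orthoPoly x y k * orthoQuot x y k a := by
  induction a using Nat.twoStepInduction with
  | zero => simp [orthoQuot]
  | one =>
    rw [show (k + 1) * 1 + k = 2 * k + 1 by ring, orthoPoly_two_mul_add_one, orthoQuot]
  | more a ih1 ih2 =>
    rw [show (k + 1) * (a + 2) + k = (k + 1) * (a + 1) + k + (k + 1) by ring,
      orthoPoly_reflect x y (by nlinarith), ih2,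
      show (k + 1) * (a + 1) + k - (k + 1) = (k + 1) * a + k by
        rw [Nat.sub_eq_iff_eq_add (by nlinarith)]; ring, ih1, orthoQuot]
    ring

theorem powQuot_succ (m N : ℕ) : powQuot x y m (N + 1) = x ^ m * powQuot x y m N + (y ^ m) ^ N := by
  rw [powQuot, powQuot, Finset.sum_range_succ, Finset.mul_sum]
  congr 1
  · refine Finset.sum_congr rfl fun i hi => ?_
    have := Finset.mem_range.1 hi
    rw [show N + 1 - 1 - i = N - 1 - i + 1 by omega]
    ring
  · simp

theorem orthoQuot_coeff_zero (k a : ℕ) : (orthoQuot x y k a).coeff 0 =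
    (-1) ^ (a * (k + 1)) * powQuot x y (k + 1) (a + 1) := by
  induction a using Nat.twoStepInduction with
  | zero => simp [orthoQuot, powQuot]
  | one =>
    rw [orthoQuot, reflPoly_coeff_zero, powQuot_succ, powQuot_succ]
    simp [powQuot]
  | more a ih1 ih2 =>
    have h : (-1 : R) ^ ((a + 2) * (k + 1)) = (-1) ^ (a * (k + 1)) := by
      rw [add_mul, pow_add, pow_mul (-1) 2]; simp
    have h' : (-1 : R) ^ (k + 1) * (-1) ^ ((a + 1) * (k + 1)) = (-1) ^ (a * (k + 1)) := by
      rw [← h]; ring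
    simp only [orthoQuot, coeff_sub, mul_coeff_zero, ih1, ih2, coeff_C_zero, reflPoly_coeff_zero]
    rw [show (-1 : R) ^ (k + 1) * (x ^ (k + 1) + y ^ (k + 1)) * ((-1) ^ ((a + 1) * (k + 1)) *
      powQuot x y (k + 1) (a + 1 + 1)) = (-1 : R) ^ (k + 1) * (-1) ^ ((a + 1) * (k + 1)) *
        ((x ^ (k + 1) + y ^ (k + 1)) * powQuot x y (k + 1) (a + 1 + 1)) by ring, h', h,
      powQuot_succ x y _ (a + 2), powQuot_succ x y _ (a + 1)]
    ring

/-- Multiplication by `f` acts on multiples of `orthoPoly x y k` modulo `X * orthoPoly x y k` as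
its constant term. -/
theorem dvd_orthoPoly_mul_sub (k : ℕ) (f g : R[X]) :
    X * orthoPoly x y k ∣ orthoPoly x y k * g * f - C (f.coeff 0) * (orthoPoly x y k * g) := by
  obtain ⟨u, hu⟩ := X_dvd_sub_C (p := f)
  exact ⟨g * u, by linear_combination orthoPoly x y k * g * hu⟩

theorem dvd_orthoPoly_reflect (k a : ℕ) {j : ℕ} (hj : j ≤ k) :
    X * orthoPoly x y k ∣ orthoPoly x y ((k + 1) * a + k + j) -
      (C (-(x * y) ^ j) * orthoPoly x y ((k + 1) * a + (k - j)) +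
        C ((reflPoly x y j).coeff 0) * orthoPoly x y ((k + 1) * a + k)) := by
  have h := dvd_orthoPoly_mul_sub x y k (reflPoly x y j) (orthoQuot x y k a)
  rw [← orthoPoly_eq_mul_orthoQuot] at h
  rw [orthoPoly_reflect x y (by omega), Nat.add_sub_assoc hj]
  convert h using 1
  simp only [map_neg]
  ring

theorem dvd_orthoPoly_sub_C_mul (k a : ℕ) :
    X * orthoPoly x y k ∣ orthoPoly x y ((k + 1) * a + k) -
      C ((orthoQuot x y k a).coeff 0) * orthoPoly x y k := by
  have h := dvd_orthoPoly_mul_sub x y k (orthoQuot x y k a) 1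
  rwa [mul_one, ← orthoPoly_eq_mul_orthoQuot] at h

theorem X_mul_orthoPoly_monic (k : ℕ) : (X * orthoPoly x y k).Monic :=
  monic_X.mul (orthoPoly_monic x y k)

theorem remDet_orthoPoly [Nontrivial R] (k : ℕ) :
    remDet (X * orthoPoly x y k) (fun j : Fin (k + 1) => orthoPoly x y j) = 1 := by
  have hrem (i : Fin (k + 1)) : orthoPoly x y i %ₘ (X * orthoPoly x y k) = orthoPoly x y i := by
    refine (modByMonic_eq_self_iff (X_mul_orthoPoly_monic x y k)).2 (degree_lt_degree ?_)
    rw [monic_X.natDegree_mul (orthoPoly_monic x y k), natDegree_X, orthoPoly_natDegree,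
      orthoPoly_natDegree]
    omega
  rw [remDet, Matrix.det_of_isLowerTriangular]
  · refine Finset.prod_eq_one fun i _ => ?_
    have := (orthoPoly_monic x y i).coeff_natDegree
    rw [orthoPoly_natDegree] at this
    rw [Matrix.of_apply, hrem, this]
  · intro i j hij
    rw [Matrix.of_apply, hrem]
    refine coeff_eq_zero_of_natDegree_lt ?_
    rw [orthoPoly_natDegree]
    exact hij

/-- The last member of the block is replaced by p_k, of which it is a scalar multiple modulo X p_k;
so these scalars do not accumulate. Each passage to the preceding block reverses the other k members
and scales them by -(xy)^(b+1). -/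
theorem remDet_block [Nontrivial R] (k a : ℕ) :
    remDet (X * orthoPoly x y k) (Fin.snoc (α := fun _ => R[X])
      (fun b : Fin k => orthoPoly x y ((k + 1) * a + b)) (orthoPoly x y k)) =
      (-(x * y)) ^ (a * (k + 1).choose 2) := by
  induction a with
  | zero =>
    rw [zero_mul, pow_zero, ← remDet_orthoPoly x y k]
    congr 1
    ext1 j
    refine Fin.lastCases ?_ (fun b => ?_) j <;> simp
  | succ a ih =>
    rw [remDet_eq_of_castSucc (X_mul_orthoPoly_monic x y k) (h' := Fin.snoc (α := fun _ => R[X])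
      (fun b : Fin k => orthoPoly x y ((k + 1) * a + b)) (orthoPoly x y k)) Fin.revPerm
      (fun b => -(x * y) ^ (b + 1 : ℕ)) (fun b => (reflPoly x y (b + 1)).coeff 0 *
        (orthoQuot x y k a).coeff 0) 1, ih, Equiv.Perm.sign_finRevPerm]
    · have hprod : ∏ b : Fin k, -(x * y) ^ (b + 1 : ℕ) =
          (-1) ^ k * (x * y) ^ (k + 1).choose 2 := by
        rw [Finset.prod_neg, Finset.prod_pow_eq_pow_sum,
          Fin.sum_univ_eq_sum_range (fun i => i + 1), Finset.card_univ, Fintype.card_fin,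
          Nat.choose_two_right, ← Finset.sum_range_id, Finset.sum_range_succ']
        simp
      have hch : (k + 1).choose 2 = k + k.choose 2 := by
        rw [Nat.choose_succ_succ' k 1, Nat.choose_one_right]
      rw [hprod, add_mul, pow_add, neg_pow (x * y) (1 * _), one_mul]
      nth_rw 4 [hch]
      push_cast
      ring
    · intro b
      have h1 := dvd_orthoPoly_reflect x y k a (j := b + 1) (by omega)
      have h2 := (dvd_orthoPoly_sub_C_mul x y k a).mul_left
        (C ((reflPoly x y (b + 1)).coeff 0))
      have h3 := dvd_add h1 h2
      have hrev : (k - (b + 1) : ℕ) = (Fin.revPerm b : Fin k) := by simp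
      rw [hrev, show (k + 1) * a + k + (b + 1 : ℕ) = (k + 1) * (a + 1) + b by ring] at h3
      simp only [Fin.snoc_castSucc, Fin.snoc_last]
      convert h3 using 1
      simp only [map_mul]
      ring
    · simp

end

/-! ### The remainder determinant in the four residue classes. -/

section

variable {R : Type*} [CommRing R] (x y : R)

theorem remDet_orthoPoly_block [Nontrivial R] (k a : ℕ) :
    remDet (X * orthoPoly x y k) (fun b : Fin (k + 1) => orthoPoly x y ((k + 1) * a + b)) =
      (-1) ^ (a * (k + 1)) * powQuot x y (k + 1) (a + 1) *
        (-(x * y)) ^ (a * (k + 1).choose 2) := by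
  rw [← orthoQuot_coeff_zero, ← remDet_block, remDet_eq_of_castSucc (X_mul_orthoPoly_monic x y k)
    (h' := Fin.snoc (α := fun _ => R[X])
      (fun b : Fin k => orthoPoly x y ((k + 1) * a + b)) (orthoPoly x y k)) 1
    (fun _ => 1) (fun _ => 0) ((orthoQuot x y k a).coeff 0)]
  · simp
  · intro b
    simp
  · simpa using dvd_orthoPoly_sub_C_mul x y k a

/-- The differences telescope: subtracting neighbouring rows on the right is unitriangular. -/
theorem remDet_orthoDiff {T : R[X]} (hT : T.Monic) (n m : ℕ) :
    remDet T (fun i : Fin m => orthoDiff x y (n + 1 + i)) =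
      remDet T (fun i : Fin m => orthoPoly x y (n + 1 + i) - orthoPoly x y n) := by
  let Z : Matrix (Fin m) (Fin m) R := Matrix.of fun i j =>
    (if (j : ℕ) = i then 1 else 0) - if (i : ℕ) = 0 then 0 else if (j : ℕ) = i - 1 then 1 else 0
  have hZ : Z.det = 1 := by
    rw [Matrix.det_of_isLowerTriangular]
    · refine Finset.prod_eq_one fun i _ => ?_
      simp only [Z, Matrix.of_apply, if_true]
      split_ifs <;> first | omega | simp
    · intro i j hij
      have : (i : ℕ) < j := hij
      simp only [Z, Matrix.of_apply]
      split_ifs <;> first | omega | simp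
  rw [remDet_eq_det_mul hT Z (h' := fun i => orthoPoly x y (n + 1 + i) - orthoPoly x y n), hZ,
    one_mul]
  rintro ⟨i, hi⟩
  simp only [Z, Matrix.of_apply, map_sub, sub_mul, Finset.sum_sub_distrib]
  rw [sum_C_ite_mul hi 1 fun j => orthoPoly x y (n + 1 + j) - orthoPoly x y n]
  rcases i with _ | i
  · simp [orthoDiff]
  · simp only [Nat.add_sub_cancel, Nat.succ_ne_zero, if_false]
    rw [sum_C_ite_mul (by omega) 1 fun j => orthoPoly x y (n + 1 + j) - orthoPoly x y n]
    rw [show n + 1 + (i + 1) = n + 1 + i + 1 by ring, orthoDiff]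
    simp

/-- The subtracted p_{n-1} is itself a scalar multiple of p_k modulo X p_k, so it only alters the
scalar of the last row, to a difference of two constant terms. -/
theorem remDet_orthoDiff_block_zero [Nontrivial R] (k a : ℕ) :
    remDet (X * orthoPoly x y k)
      (fun i : Fin (k + 1) => orthoDiff x y ((k + 1) * (a + 1) + i)) =
      ((-1) ^ ((a + 1) * (k + 1)) * powQuot x y (k + 1) (a + 2) -
        (-1) ^ (a * (k + 1)) * powQuot x y (k + 1) (a + 1)) *
          (-(x * y)) ^ ((a + 1) * (k + 1).choose 2) := by
  have hidx : (k + 1) * (a + 1) = (k + 1) * a + k + 1 := by ring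
  have hdvd := dvd_orthoPoly_sub_C_mul x y k a
  have h := remDet_orthoDiff x y (X_mul_orthoPoly_monic x y k) ((k + 1) * a + k) (k + 1)
  rw [← hidx] at h
  rw [h, ← orthoQuot_coeff_zero, ← orthoQuot_coeff_zero, ← remDet_block,
    remDet_eq_of_castSucc (X_mul_orthoPoly_monic x y k) (h' := Fin.snoc (α := fun _ => R[X])
      (fun b : Fin k => orthoPoly x y ((k + 1) * (a + 1) + b)) (orthoPoly x y k)) 1
    (fun _ => 1) (fun _ => -(orthoQuot x y k a).coeff 0)
    ((orthoQuot x y k (a + 1)).coeff 0 - (orthoQuot x y k a).coeff 0)]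
  · simp
  · intro b
    convert hdvd.neg_right using 1
    simp
    ring
  · convert dvd_sub (dvd_orthoPoly_sub_C_mul x y k (a + 1)) hdvd using 1
    simp
    ring

/-- All rows but the last are differences within one block. With N = (k+1)a + k, the last is p_{N+1}
- p_N, congruent to xy (p_N - p_{N-1}) - (1+x)(1+y) p_N. -/
theorem remDet_orthoDiff_block_one [Nontrivial R] {k : ℕ} (hk : 1 ≤ k) (a : ℕ) :
    remDet (X * orthoPoly x y k)
      (fun i : Fin (k + 1) => orthoDiff x y ((k + 1) * a + 1 + i)) =
      (-1) ^ (k + 1) * ((1 + x) * (1 + y)) *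
        ((-1) ^ (a * (k + 1)) * powQuot x y (k + 1) (a + 1) *
          (-(x * y)) ^ (a * (k + 1).choose 2)) := by
  have hT := X_mul_orthoPoly_monic x y k
  let D : ℕ → R[X] := fun i => if i = k then orthoPoly x y ((k + 1) * a + k) else
    orthoPoly x y ((k + 1) * a + i + 1) - orthoPoly x y ((k + 1) * a + i)
  let Z : Matrix (Fin (k + 1)) (Fin (k + 1)) R := Matrix.of fun i j =>
    if (i : ℕ) = k then (if (j : ℕ) = k - 1 then x * y else 0) +
      (if (j : ℕ) = k then -((1 + x) * (1 + y)) else 0)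
    else if (j : ℕ) = i then 1 else 0
  let Y : Matrix (Fin (k + 1)) (Fin (k + 1)) R := Matrix.of fun i j =>
    if (i : ℕ) = k then (if (j : ℕ) = k then 1 else 0)
    else (if (j : ℕ) = i + 1 then 1 else 0) - (if (j : ℕ) = i then 1 else 0)
  have hZ : Z.det = -((1 + x) * (1 + y)) := by
    rw [Matrix.det_of_isLowerTriangular, Fin.prod_univ_castSucc, Finset.prod_eq_one]
    · simp only [Z, Matrix.of_apply, Fin.val_last, if_true]
      rw [if_neg (by omega)]
      simp
    · intro b _
      simp [Z, b.2.ne]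
    · intro i j hij
      have : (i : ℕ) < j := hij
      simp only [Z, Matrix.of_apply]
      split_ifs <;> first | omega | simp
  have hY : Y.det = (-1) ^ k := by
    rw [Matrix.det_of_isUpperTriangular, Fin.prod_univ_castSucc,
      Finset.prod_congr rfl (g := fun _ => (-1 : R))]
    · simp [Y]
    · intro b _
      simp [Y, b.2.ne]
    · intro i j hij
      have : (j : ℕ) < i := hij
      simp only [Y, Matrix.of_apply]
      split_ifs <;> first | omega | simp
  rw [remDet_eq_det_mul hT Z (h' := fun i => D i), hZ, remDet_eq_det_mul hT Y
    (h' := fun b => orthoPoly x y ((k + 1) * a + b)), hY, remDet_orthoPoly_block]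
  · ring
  · rintro ⟨i, hi⟩
    by_cases hik : i = k
    · subst hik
      simp only [Y, D, Matrix.of_apply, if_true]
      rw [sum_C_ite_mul hi 1 fun b => orthoPoly x y ((i + 1) * a + b)]
      simp
    · simp only [Y, D, Matrix.of_apply, if_neg hik, map_sub, sub_mul, Finset.sum_sub_distrib]
      rw [sum_C_ite_mul hi 1 fun b => orthoPoly x y ((k + 1) * a + b),
        sum_C_ite_mul (by omega) 1 fun b => orthoPoly x y ((k + 1) * a + b)]
      simp [add_assoc]
  · rintro ⟨i, hi⟩
    by_cases hik : i = k
    · obtain ⟨k, rfl⟩ : ∃ l, k = l + 1 := ⟨k - 1, by omega⟩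
      subst hik
      simp only [Z, Matrix.of_apply, if_true, map_add C, add_mul (_ : R[X]), Finset.sum_add_distrib]
      rw [sum_C_ite_mul hi _ D, sum_C_ite_mul (by omega) _ D]
      simp only [D, if_true, Nat.add_sub_cancel]
      rw [if_neg (by omega), show (k + 1 + 1) * a + 1 + (k + 1) = (k + 1 + 1) * a + (k + 1) + 1 by
        ring, orthoDiff, show (k + 1 + 1) * a + (k + 1) + 1 = (k + 1 + 1) * a + k + 2 by ring,
        orthoPoly_add_two, show (k + 1 + 1) * a + k + 1 = (k + 1 + 1) * a + (k + 1) by ring,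
        orthoPoly_eq_mul_orthoQuot]
      -- The discarded term is X p_N, and p_N is p_k times this quotient.
      refine ⟨orthoQuot x y (k + 1) a, ?_⟩
      simp only [map_mul, map_add, map_neg, map_one]
      ring
    · simp only [Z, Matrix.of_apply, if_neg hik]
      rw [sum_C_ite_mul hi 1 D]
      simp only [D, if_neg hik]
      rw [show (k + 1) * a + 1 + i = (k + 1) * a + i + 1 by ring, orthoDiff]
      simp

/-- Row i is p_{N+i} - p_{N-1} with N = (k+1)a + k. In terms of `G`, which lists the block backwards
with first entry p_N - p_{N-1}, the rows are triangular. The term -p_{N-1} changes only the diagonal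
entry at i = 1, to -xy - (x+y) - 1 = -(1+x)(1+y). -/
theorem remDet_orthoDiff_block_last [Nontrivial R] {k : ℕ} (hk : 2 ≤ k) (a : ℕ) :
    remDet (X * orthoPoly x y k)
      (fun i : Fin (k + 1) => orthoDiff x y ((k + 1) * a + k + i)) =
      (-1) ^ k * ((1 + x) * (1 + y)) * (x * y) ^ ((k + 1).choose 2 - 1) *
        (-1) ^ (k + 1).choose 2 *
        ((-1) ^ (a * (k + 1)) * powQuot x y (k + 1) (a + 1) *
          (-(x * y)) ^ (a * (k + 1).choose 2)) := by
  obtain ⟨l, rfl⟩ : ∃ l, k = l + 2 := ⟨k - 2, by omega⟩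
  generalize hk' : l + 2 = k
  have hT := X_mul_orthoPoly_monic x y k
  let u : ℕ → R[X] := fun b => orthoPoly x y ((k + 1) * a + b)
  let v : ℕ → R := fun j => (reflPoly x y j).coeff 0
  let G : ℕ → R[X] := fun i => if i = 0 then u k - u (k - 1) else u (k - i)
  let Z : Matrix (Fin (k + 1)) (Fin (k + 1)) R := Matrix.of fun i j =>
    if (i : ℕ) = 0 then (if (j : ℕ) = 0 then 1 else 0) else
      (if (j : ℕ) = i then -(x * y) ^ (i : ℕ) else 0) + (if (j : ℕ) = 0 then v i else 0) +
      (if (j : ℕ) = 1 then v i - 1 else 0)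
  let Y : Matrix (Fin (k + 1)) (Fin (k + 1)) R := Matrix.of fun i j =>
    (if (j : ℕ) = i then 1 else 0) + if (i : ℕ) = 0 then (if (j : ℕ) = 1 then -1 else 0) else 0
  have hZ : Z.det = (-1) ^ k * ((1 + x) * (1 + y)) * (x * y) ^ ((k + 1).choose 2 - 1) := by
    rw [Matrix.det_of_isLowerTriangular]
    · subst hk'
      rw [Fin.prod_univ_succ, Fin.prod_univ_succ]
      have h0 : Z 0 0 = 1 := by simp [Z]
      have h1 : Z (Fin.succ 0) (Fin.succ 0) = -((1 + x) * (1 + y)) := by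
        simp [Z, v, reflPoly]; ring
      have h2 (i : Fin (l + 1)) : Z i.succ.succ i.succ.succ = -(x * y) ^ (i + 2 : ℕ) := by
        simp [Z]
      have hs : (l + 2 + 1).choose 2 - 1 = ∑ i ∈ range (l + 1), (i + 2) := by
        rw [Nat.choose_two_right, ← Finset.sum_range_id, Finset.sum_range_succ',
          Finset.sum_range_succ']
        simp
      rw [h0, h1, Finset.prod_congr rfl fun i _ => h2 i, Finset.prod_neg,
        Finset.prod_pow_eq_pow_sum, Fin.sum_univ_eq_sum_range (fun i => i + 2), hs,
        Finset.card_univ, Fintype.card_fin]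
      ring
    · intro i j hij
      have : (i : ℕ) < j := hij
      simp only [Z, Matrix.of_apply]
      split_ifs <;> first | omega | simp
  have hY : Y.det = 1 := by
    rw [Matrix.det_of_isUpperTriangular]
    · refine Finset.prod_eq_one fun i _ => ?_
      simp only [Y, Matrix.of_apply, if_true]
      split_ifs <;> first | omega | simp
    · intro i j hij
      have : (j : ℕ) < i := hij
      simp only [Y, Matrix.of_apply]
      split_ifs <;> first | omega | simp
  have hrev : remDet (X * orthoPoly x y k) (fun i : Fin (k + 1) => u (k - i)) =
      (-1) ^ (k + 1).choose 2 * remDet (X * orthoPoly x y k) (fun i : Fin (k + 1) => u i) := by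
    have h := remDet_comp_perm (X * orthoPoly x y k) Fin.revPerm fun i : Fin (k + 1) => u i
    rw [Equiv.Perm.sign_finRevPerm] at h
    push_cast at h
    rw [← h]
    congr 1
    ext1 i
    simp
  have hidx : (k + 1) * a + k = (k + 1) * a + (k - 1) + 1 := by omega
  rw [hidx, remDet_orthoDiff x y hT, ← hidx, remDet_eq_det_mul hT Z (h' := fun i => G i), hZ,
    remDet_eq_det_mul hT Y (h' := fun i => u (k - i)), hY, hrev, remDet_orthoPoly_block]
  · ring
  · rintro ⟨i, hi⟩
    simp only [Y, Matrix.of_apply, map_add C, add_mul (_ : R[X]), Finset.sum_add_distrib]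
    rw [sum_C_ite_mul hi _ fun i => u (k - i)]
    by_cases hi0 : i = 0
    · simp only [hi0, if_true, G]
      rw [sum_C_ite_mul (by omega) _ fun i => u (k - i)]
      simp [sub_eq_add_neg]
    · simp [hi0, G]
  · rintro ⟨i, hi⟩
    by_cases hi0 : i = 0
    · simp only [Z, Matrix.of_apply, hi0, if_true]
      rw [sum_C_ite_mul (by omega) _ G]
      simp [G, u]
    · simp only [Z, Matrix.of_apply, hi0, if_false, map_add C, add_mul (_ : R[X]), Finset.sum_add_distrib]
      rw [sum_C_ite_mul hi _ G, sum_C_ite_mul (by omega) _ G, sum_C_ite_mul (by omega) _ G]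
      simp only [G, if_true, if_neg hi0, one_ne_zero, if_false]
      convert dvd_orthoPoly_reflect x y k a (j := i) (by omega) using 1
      simp only [map_sub, map_one, u, v]
      ring

/-- After reflection no row involves the first member of the block: the indices r + i, 2k - r - i, k
and r - 1 that occur are all positive. So k + 1 rows lie in the span of k polynomials. -/
theorem remDet_orthoDiff_block_eq_zero {k r : ℕ} (hr : 2 ≤ r) (hrk : r < k) (a : ℕ) :
    remDet (X * orthoPoly x y k)
      (fun i : Fin (k + 1) => orthoDiff x y ((k + 1) * a + r + i)) = 0 := by
  have hT := X_mul_orthoPoly_monic x y k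
  let u : ℕ → R[X] := fun b => orthoPoly x y ((k + 1) * a + b)
  let v : ℕ → R := fun j => (reflPoly x y j).coeff 0
  let Z : Matrix (Fin (k + 1)) (Fin (k + 1)) R := Matrix.of fun i j =>
    (if r + i ≤ k then (if (j : ℕ) = r + i then 1 else 0) else
      (if (j : ℕ) = k - (r + i - k) then -(x * y) ^ (r + i - k : ℕ) else 0) +
      (if (j : ℕ) = k then v (r + i - k) else 0)) - (if (j : ℕ) = r - 1 then 1 else 0)
  have hZ : Z.det = 0 := by
    refine Matrix.det_eq_zero_of_column_eq_zero 0 fun i => ?_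
    have := i.2
    have h0 : ((0 : Fin (k + 1)) : ℕ) = 0 := rfl
    simp only [Z, Matrix.of_apply]
    rw [if_neg (show ¬((0 : Fin (k + 1)) : ℕ) = r + i by omega),
      if_neg (show ¬((0 : Fin (k + 1)) : ℕ) = k - (r + i - k) by omega),
      if_neg (show ¬((0 : Fin (k + 1)) : ℕ) = k by omega),
      if_neg (show ¬((0 : Fin (k + 1)) : ℕ) = r - 1 by omega)]
    simp
  have hidx : (k + 1) * a + r = (k + 1) * a + (r - 1) + 1 := by omega
  rw [hidx, remDet_orthoDiff x y hT, ← hidx, remDet_eq_det_mul hT Z (h' := fun i => u i), hZ,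
    zero_mul]
  rintro ⟨i, hi⟩
  simp only [Z, Matrix.of_apply, map_sub, sub_mul, Finset.sum_sub_distrib]
  rw [sum_C_ite_mul (by omega) _ u]
  by_cases hik : r + i ≤ k
  · simp only [if_pos hik]
    rw [sum_C_ite_mul (by omega) _ u]
    simp [u, add_assoc]
  · simp only [if_neg hik, map_add C, add_mul (_ : R[X]), Finset.sum_add_distrib]
    rw [sum_C_ite_mul (by omega) _ u, sum_C_ite_mul (by omega) _ u]
    convert dvd_orthoPoly_reflect x y k a (j := r + i - k) (by omega) using 1
    rw [show (k + 1) * a + r + i = (k + 1) * a + k + (r + i - k) by omega]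
    simp only [map_one, u, v]
    ring

theorem powQuot_eq_div {K : Type*} [Field K] {x y : K} {m : ℕ} (h : y ^ m ≠ x ^ m) (N : ℕ) :
    powQuot x y m N = (y ^ (m * N) - x ^ (m * N)) / (y ^ m - x ^ m) :=
  eq_div_of_mul_eq (sub_ne_zero.2 h) (powQuot_mul x y m N)

end

/-! ### Collecting signs and exponents. -/

section

variable {R : Type*} [CommRing R] (x y : R)

theorem det_shiftedPrefixHankel_of_eq_mul [Nontrivial R] {n k n₁ : ℕ} (hn : 1 ≤ n)
    (h : n = (k + 1) * n₁) : (shiftedPrefixHankel x y n k).det =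
      (-1) ^ (n₁ * (k + 1).choose 2) * (x * y) ^ ((k + 1) ^ 2 * (n₁ + 1).choose 2 - n) *
        (powQuot x y (k + 1) (n₁ + 1) + (-1) ^ k * powQuot x y (k + 1) n₁) := by
  -- The block evaluation uses p_{n-1}, of index (k+1)a + k.
  obtain ⟨a, rfl⟩ : ∃ a, n₁ = a + 1 := by
    rcases n₁ with _ | a
    · simp at h; omega
    · exact ⟨a, rfl⟩
  have hexp : (k + 1) ^ 2 * (a + 1 + 1).choose 2 - n =
      n.choose 2 + (a + 1) * (k + 1).choose 2 := by
    rw [Nat.sub_eq_iff_eq_add']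
    · rw [h]
      qify
      simp only [Nat.cast_choose_two]
      push_cast
      ring
    · rw [h, Nat.choose_succ_succ' (a + 1) 1, Nat.choose_one_right]
      nlinarith [Nat.zero_le ((k + 1) ^ 2 * (a + 1).choose 2), Nat.zero_le (k * (k + 1) * (a + 1))]
  have h1 : (-1 : R) ^ (n * (k + 1)) * (-1) ^ ((a + 1) * (k + 1)) = 1 := by
    rw [← pow_add, h]
    refine Even.neg_one_pow ?_
    simp only [parity_simps]
    tauto
  have h2 : (-1 : R) ^ (n * (k + 1)) * (-1) ^ (a * (k + 1)) = (-1) ^ (k + 1) := by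
    rw [← pow_add, h]
    refine neg_one_pow_congr ?_
    simp only [parity_simps]
    tauto
  rw [hexp, det_shiftedPrefixHankel, pow_add (x * y)]
  subst h
  rw [remDet_orthoDiff_block_zero, neg_pow (x * y)]
  rw [pow_succ (-1) k] at h2
  generalize (-1 : R) ^ ((k + 1) * (a + 1) * (k + 1)) = S at *
  generalize (-1 : R) ^ ((a + 1) * (k + 1)) = A at *
  generalize (-1 : R) ^ (a * (k + 1)) = B at *
  generalize (-1 : R) ^ ((a + 1) * (k + 1).choose 2) = E
  generalize (x * y) ^ ((a + 1) * (k + 1).choose 2) = Q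
  generalize (x * y) ^ (((k + 1) * (a + 1)).choose 2) = P
  linear_combination E * Q * P * powQuot x y (k + 1) (a + 2) * h1 -
    E * Q * P * powQuot x y (k + 1) (a + 1) * h2

theorem det_shiftedPrefixHankel_of_eq_mul_add_one [Nontrivial R] {n k n₁ : ℕ} (hk : 1 ≤ k)
    (h : n = (k + 1) * n₁ + 1) : (shiftedPrefixHankel x y n k).det =
      (-1) ^ (n₁ * (k + 1).choose 2) * (x * y) ^ ((k + 1) ^ 2 * (n₁ + 1).choose 2) *
        ((1 + x) * (1 + y) * powQuot x y (k + 1) (n₁ + 1)) := by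
  have hexp : (k + 1) ^ 2 * (n₁ + 1).choose 2 = n.choose 2 + n₁ * (k + 1).choose 2 := by
    rw [h]
    qify
    simp only [Nat.cast_choose_two]
    push_cast
    ring
  have h1 : (-1 : R) ^ (n * (k + 1)) * (-1) ^ (k + 1) * (-1) ^ (n₁ * (k + 1)) = 1 := by
    rw [← pow_add, ← pow_add, h]
    refine Even.neg_one_pow ?_
    simp only [parity_simps]
    tauto
  rw [hexp, det_shiftedPrefixHankel, pow_add (x * y)]
  subst h
  rw [remDet_orthoDiff_block_one x y hk, neg_pow (x * y)]
  generalize (-1 : R) ^ (((k + 1) * n₁ + 1) * (k + 1)) = S at *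
  generalize (-1 : R) ^ (n₁ * (k + 1)) = A at *
  generalize (-1 : R) ^ (k + 1) = B at *
  generalize (-1 : R) ^ (n₁ * (k + 1).choose 2) = E
  generalize (x * y) ^ (n₁ * (k + 1).choose 2) = Q
  generalize (x * y) ^ (((k + 1) * n₁ + 1).choose 2) = P
  linear_combination E * Q * P * ((1 + x) * (1 + y) * powQuot x y (k + 1) (n₁ + 1)) * h1

theorem det_shiftedPrefixHankel_of_eq_mul_add_self [Nontrivial R] {n k n₁ : ℕ} (hk : 2 ≤ k)
    (h : n = (k + 1) * n₁ + k) : (shiftedPrefixHankel x y n k).det =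
      (-1) ^ ((n₁ + 1) * (k + 1).choose 2 + k) *
        (x * y) ^ ((k + 1) ^ 2 * (n₁ + 1).choose 2 + (k ^ 2 - 1) * (n₁ + 1)) *
        ((1 + x) * (1 + y) * powQuot x y (k + 1) (n₁ + 1)) := by
  have hexp : (k + 1) ^ 2 * (n₁ + 1).choose 2 + (k ^ 2 - 1) * (n₁ + 1) =
      n.choose 2 + (((k + 1).choose 2 - 1) + n₁ * (k + 1).choose 2) := by
    have hc : 1 ≤ (k + 1).choose 2 := Nat.choose_pos (by omega)
    have hc' : 1 ≤ k ^ 2 := Nat.one_le_pow _ _ (by omega)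
    rw [h]
    qify [hc, hc']
    simp only [Nat.cast_choose_two]
    push_cast
    ring
  have h1 : (-1 : R) ^ (n * (k + 1)) * (-1) ^ (n₁ * (k + 1)) = 1 := by
    rw [← pow_add, h]
    refine Even.neg_one_pow ?_
    simp only [parity_simps]
    tauto
  rw [hexp, det_shiftedPrefixHankel, pow_add (x * y), pow_add (x * y), pow_add (-1 : R), add_mul,
    pow_add (-1 : R), one_mul]
  subst h
  rw [remDet_orthoDiff_block_last x y hk, neg_pow (x * y)]
  generalize (-1 : R) ^ (((k + 1) * n₁ + k) * (k + 1)) = S at *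
  generalize (-1 : R) ^ (n₁ * (k + 1)) = A at *
  generalize (-1 : R) ^ k = B at *
  generalize (-1 : R) ^ (n₁ * (k + 1).choose 2) = E
  generalize (-1 : R) ^ ((k + 1).choose 2) = F
  generalize (x * y) ^ (n₁ * (k + 1).choose 2) = Q
  generalize (x * y) ^ ((k + 1).choose 2 - 1) = U
  generalize (x * y) ^ (((k + 1) * n₁ + k).choose 2) = P
  linear_combination B * E * F * Q * U * P *
    ((1 + x) * (1 + y) * powQuot x y (k + 1) (n₁ + 1)) * h1

theorem det_shiftedPrefixHankel_eq_zero [Nontrivial R] {n k : ℕ} (h0 : ¬n ≡ 0 [MOD k + 1])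
    (h1 : ¬n ≡ 1 [MOD k + 1]) (hk : ¬n ≡ k [MOD k + 1]) :
    (shiftedPrefixHankel x y n k).det = 0 := by
  have hlt := Nat.mod_lt n (Nat.succ_pos k)
  have hdiv : n = (k + 1) * (n / (k + 1)) + n % (k + 1) := (Nat.div_add_mod n (k + 1)).symm
  rw [Nat.succ_eq_add_one] at hlt
  have h0' : n % (k + 1) ≠ 0 := fun h => h0 (by rw [Nat.ModEq, h, Nat.zero_mod])
  have hk' : n % (k + 1) ≠ k := fun h => hk (by
    rw [Nat.ModEq, h, Nat.mod_eq_of_lt (Nat.lt_succ_self k)])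
  have h1' : n % (k + 1) ≠ 1 := fun h => h1 (by
    rw [Nat.ModEq, h, Nat.mod_eq_of_lt (by omega)])
  rw [det_shiftedPrefixHankel]
  generalize n % (k + 1) = r at *
  generalize n / (k + 1) = a at *
  subst hdiv
  rw [remDet_orthoDiff_block_eq_zero x y (by omega) (by omega), mul_zero]

end

theorem theorem4 (n k : ℕ) (hn : 1 ≤ n) :
    -- the formulas with literal fractions, in a field, for non-vanishing denominator
    (∀ (K : Type*) [Field K] (x y : K), y ^ (k + 1) ≠ x ^ (k + 1) →
      (∀ n₁ : ℕ, n = (k + 1) * n₁ →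
        (shiftedPrefixHankel x y n k).det =
          (-1) ^ (n₁ * (k + 1).choose 2) * (x * y) ^ ((k + 1) ^ 2 * (n₁ + 1).choose 2 - n) *
            ((y ^ ((k + 1) * (n₁ + 1)) - x ^ ((k + 1) * (n₁ + 1))) / (y ^ (k + 1) - x ^ (k + 1)) +
              (-1) ^ k *
                ((y ^ ((k + 1) * n₁) - x ^ ((k + 1) * n₁)) / (y ^ (k + 1) - x ^ (k + 1))))) ∧
      (1 ≤ k → ∀ n₁ : ℕ, n = (k + 1) * n₁ + 1 →
        (shiftedPrefixHankel x y n k).det =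
          (-1) ^ (n₁ * (k + 1).choose 2) * (x * y) ^ ((k + 1) ^ 2 * (n₁ + 1).choose 2) *
            ((1 + x) * (1 + y) * (y ^ ((k + 1) * (n₁ + 1)) - x ^ ((k + 1) * (n₁ + 1))) /
              (y ^ (k + 1) - x ^ (k + 1)))) ∧
      (2 ≤ k → ∀ n₁ : ℕ, n = (k + 1) * n₁ + k →
        (shiftedPrefixHankel x y n k).det =
          (-1) ^ ((n₁ + 1) * (k + 1).choose 2 + k) *
            (x * y) ^ ((k + 1) ^ 2 * (n₁ + 1).choose 2 + (k ^ 2 - 1) * (n₁ + 1)) *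
            ((1 + x) * (1 + y) * (y ^ ((k + 1) * (n₁ + 1)) - x ^ ((k + 1) * (n₁ + 1))) /
              (y ^ (k + 1) - x ^ (k + 1)))) ∧
      (¬ n ≡ 0 [MOD k + 1] → ¬ n ≡ 1 [MOD k + 1] → ¬ n ≡ k [MOD k + 1] →
        (shiftedPrefixHankel x y n k).det = 0)) ∧
    -- the formulas in every commutative ring, with the fractions read as polynomials
    (∀ (R : Type*) [CommRing R] (x y : R),
      (∀ n₁ : ℕ, n = (k + 1) * n₁ →
        (shiftedPrefixHankel x y n k).det =
          (-1) ^ (n₁ * (k + 1).choose 2) * (x * y) ^ ((k + 1) ^ 2 * (n₁ + 1).choose 2 - n) *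
            (powQuot x y (k + 1) (n₁ + 1) + (-1) ^ k * powQuot x y (k + 1) n₁)) ∧
      (1 ≤ k → ∀ n₁ : ℕ, n = (k + 1) * n₁ + 1 →
        (shiftedPrefixHankel x y n k).det =
          (-1) ^ (n₁ * (k + 1).choose 2) * (x * y) ^ ((k + 1) ^ 2 * (n₁ + 1).choose 2) *
            ((1 + x) * (1 + y) * powQuot x y (k + 1) (n₁ + 1))) ∧
      (2 ≤ k → ∀ n₁ : ℕ, n = (k + 1) * n₁ + k →
        (shiftedPrefixHankel x y n k).det =
          (-1) ^ ((n₁ + 1) * (k + 1).choose 2 + k) *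
            (x * y) ^ ((k + 1) ^ 2 * (n₁ + 1).choose 2 + (k ^ 2 - 1) * (n₁ + 1)) *
            ((1 + x) * (1 + y) * powQuot x y (k + 1) (n₁ + 1))) ∧
      (¬ n ≡ 0 [MOD k + 1] → ¬ n ≡ 1 [MOD k + 1] → ¬ n ≡ k [MOD k + 1] →
        (shiftedPrefixHankel x y n k).det = 0)) := by
  refine ⟨fun K _ x y hxy => ⟨fun n₁ h => ?_, fun hk n₁ h => ?_, fun hk n₁ h => ?_,
    det_shiftedPrefixHankel_eq_zero x y⟩, fun R _ x y => ?_⟩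
  · rw [← powQuot_eq_div hxy, ← powQuot_eq_div hxy]
    exact det_shiftedPrefixHankel_of_eq_mul x y hn h
  · rw [mul_div_assoc, ← powQuot_eq_div hxy]
    exact det_shiftedPrefixHankel_of_eq_mul_add_one x y hk h
  · rw [mul_div_assoc, ← powQuot_eq_div hxy]
    exact det_shiftedPrefixHankel_of_eq_mul_add_self x y hk h
  -- The degree arguments need 1 ≠ 0; in the zero ring every identity is trivial.
  · rcases subsingleton_or_nontrivial R with _ | _
    · exact ⟨fun _ _ => Subsingleton.elim _ _, fun _ _ _ => Subsingleton.elim _ _,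
        fun _ _ _ => Subsingleton.elim _ _, fun _ _ _ => Subsingleton.elim _ _⟩
    · exact ⟨fun _ h => det_shiftedPrefixHankel_of_eq_mul x y hn h,
        fun hk _ h => det_shiftedPrefixHankel_of_eq_mul_add_one x y hk h,
        fun hk _ h => det_shiftedPrefixHankel_of_eq_mul_add_self x y hk h,
        det_shiftedPrefixHankel_eq_zero x y⟩
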